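/- Let $\mathcal{E}$ be a finite set of nonnegative reals and let $E_1,E_2,\dots$ be i.i.d. random variables with values in $\mathcal{E}$ and $\Pr(E_1>0)>0$ (the energy arrivals). Let $\bar B>0$ be the battery size, $b\in[0,\bar B]$ the initial battery level, and $\mu=\mathbb{E}[\min\{E_1,\bar B\}]$. All logarithms are to base $2$, $H$ is the Shannon entropy in bits, and $E^t=(E_1,\dots,E_t)$. An online policy $g^n=(g_1,\dots,g_n)$ consists of functions $g_t:\mathcal{E}^t\to[0,\infty)$. It is admissible, $g^n\in\mathcal{G}_n^{\mathrm{online}}(b)$, if for all $e^n\in\mathcal{E}^n$ and $1\le t\le n$ we have $g_t(e^t)\le b_t$, where $b_0=b$, $g_0=0$ and $b_t=\min\{b_{t-1}-g_{t-1}(e^{t-1})+e_t,\bar B\}$. Put $\mathscr{T}(g^n)=\frac1n\mathbb{E}\big[\sum_{t=1}^n\frac12\log(1+g_t(E^t))\big]$ and $g^n(E^n)=(g_1(E^1),\dots,g_n(E^n))$. Consider the following online policies, each defined for every length $n$. - The generalized Bernoulli policy: $g_t=\bar B q(1-q)^{t-s_t}$ with $q=\mu/\bar B$, where $s_t$ is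 the last $\tau\in\{1,\dots,t\}$ with $b_\tau=\bar B$, and $g_t=0$ if there is no such $\tau$. - For $x\in[0,\bar B]$, the binary quantization policy with level $x$: $g_t=x q'(1-q')^{t-j_t}$ with $q'=\Pr(E_1\ge x)$, where $j_t$ is the last $\tau\in\{1,\dots,t\}$ with $e_\tau\ge x$, and $g_t=0$ if there is no such $\tau$. (Here $0^0=1$.) Then: 1. Each of these policies satisfies, for every $n\ge1$, $g^n\in\mathcal{G}_n^{\mathrm{online}}(b)$ and $$\tfrac1n H(g^n(E^n))\le 1 .$$ 2. At least one of these policies achieves $$\liminf_{n\to\infty}\mathscr{T}(g^n)\ \ge\ \tfrac12\log(1+\mu)-1.80 .$$ 3. Consequently, $$\liminf_{n\to\infty}\ \max_{g^n\in\mathcal{G}_n^{\mathrm{online}}(b)}\Big\{\mathscr{T}(g^n)-\tfrac1n H(g^n(E^n))\Big\}\ \ge\ \tfrac12\log(1+\mu)-2.80 ,$$ where for every $n\ge1$ the maximum is attained. -/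

import Mathlib

open MeasureTheory ProbabilityTheory Filter

noncomputable section

namespace EnergyHarvesting

/-- An online power control policy of length `n` over the finite arrival alphabet `𝓔`: the power
of slot `t` is a function of the arrivals up to and including slot `t`. Slots are numbered from
`0`, so the slot `t : Fin n` has seen `t + 1` arrivals. Nonnegativity of the powers is part of
admissibility. -/
abbrev OnlinePolicy (𝓔 : Finset ℝ) (n : ℕ) : Type :=
  (t : Fin n) → (Fin ((t : ℕ) + 1) → 𝓔) → ℝ

/-- The battery level when slot `t` starts (after the arrival of that slot), for a battery of size
`Bmax` with initial level `b`, under the powers `g t` and the arrivals `e t`: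
`b_t = min (b_{t-1} - g_{t-1} + e_t) Bmax`, no power being spent before the first slot. -/
def battery (Bmax b : ℝ) (g e : ℕ → ℝ) : ℕ → ℝ
  | 0 => min (b + e 0) Bmax
  | t + 1 => min (battery Bmax b g e t - g t + e (t + 1)) Bmax

variable {𝓔 : Finset ℝ}

/-- The power that a policy of length `n` spends in slot `t` along the arrival sequence `e`
(`0` after the last slot). -/
def OnlinePolicy.power {n : ℕ} (g : OnlinePolicy 𝓔 n) (e : ℕ → 𝓔) (t : ℕ) : ℝ :=
  if h : t < n then g ⟨t, h⟩ (fun i => e i) else 0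

/-- The admissible online policies of length `n`, for a battery of size `Bmax` with initial level
`b`: the powers are nonnegative and never exceed the battery level, for all arrivals. Only the
first `n` terms of the arrival sequence `e` matter. -/
def admissible (𝓔 : Finset ℝ) (Bmax b : ℝ) (n : ℕ) : Set (OnlinePolicy 𝓔 n) :=
  {g | ∀ e : ℕ → 𝓔, ∀ t < n, 0 ≤ g.power e t ∧
    g.power e t ≤ battery Bmax b (g.power e) (fun i => (e i : ℝ)) t}

section Probability

variable {Ω : Type*} [MeasurableSpace Ω]

/-- The random power sequence `g^n(E^n)`. -/
def OnlinePolicy.powers {n : ℕ} (g : OnlinePolicy 𝓔 n) (E : ℕ → Ω → 𝓔) (ω : Ω) : Fin n → ℝ :=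
  fun t => g t (fun i => E i ω)

/-- Shannon entropy in bits of a discrete random variable `X`. -/
def entropy {α : Type*} (P : Measure Ω) (X : Ω → α) : ℝ :=
  ∑' x : α, Real.negMulLog (P.real (X ⁻¹' {x})) / Real.log 2

/-- The average throughput of a policy, in bits per slot. -/
def throughput {n : ℕ} (P : Measure Ω) (E : ℕ → Ω → 𝓔) (g : OnlinePolicy 𝓔 n) : ℝ :=
  (1 / (n : ℝ)) * ∫ ω, ∑ t : Fin n, (1 / 2) * Real.logb 2 (1 + g.powers E ω t) ∂P

/-- Entropy per symbol `(1/n) H(g^n(E^n))` of a policy. -/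
def entropyPerSymbol {n : ℕ} (P : Measure Ω) (E : ℕ → Ω → 𝓔) (g : OnlinePolicy 𝓔 n) : ℝ :=
  (1 / (n : ℝ)) * entropy P (g.powers E)

/-- The mean `E[min(E_t, Bmax)]` of the clipped arrivals. -/
def clippedMean (P : Measure Ω) (E : ℕ → Ω → 𝓔) (Bmax : ℝ) : ℝ :=
  ∫ ω, min (E 0 ω : ℝ) Bmax ∂P

end Probability

/-- Exponentially decaying allocation of the energy `A` with fraction `q`: the power is
`A q (1 - q) ^ k` when `k` slots have passed since the last restart, and `0` if no restart has
taken place yet. -/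
def decay (A q : ℝ) : Option ℕ → ℝ
  | none => 0
  | some k => A * q * (1 - q) ^ k

/-- The number of slots since the last arrival of size at least `x`, if there was one. -/
def quantAge (x : ℝ) : (t : ℕ) → (Fin (t + 1) → 𝓔) → Option ℕ
  | 0, w => if x ≤ (w 0 : ℝ) then some 0 else none
  | t + 1, w =>
    if x ≤ (w (Fin.last (t + 1)) : ℝ) then some 0
    else (quantAge x t (Fin.init w)).map (· + 1)

/-- The binary quantization policy with level `x` and fraction `q`: with `j` the last slot
`≤ t` whose arrival is at least `x`, the power is `x q (1 - q) ^ (t - j)`. -/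
def binaryQuantization (𝓔 : Finset ℝ) (x q : ℝ) (n : ℕ) : OnlinePolicy 𝓔 n :=
  fun t w => decay x q (quantAge x t w)

/-- The battery level under the generalized Bernoulli policy, and the number of slots since the
battery was last full, if it was full before. -/
def genBernoulliState (Bmax b q : ℝ) : (t : ℕ) → (Fin (t + 1) → 𝓔) → ℝ × Option ℕ
  | 0, w =>
    let β := min (b + (w 0 : ℝ)) Bmax
    (β, if β = Bmax then some 0 else none)
  | t + 1, w =>
    let s := genBernoulliState Bmax b q t (Fin.init w)
    let β := min (s.1 - decay Bmax q s.2 + (w (Fin.last (t + 1)) : ℝ)) Bmax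
    (β, if β = Bmax then some 0 else s.2.map (· + 1))

/-- The generalized Bernoulli policy with fraction `q`: with `s` the last slot `≤ t` in which the
battery is full, the power is `Bmax q (1 - q) ^ (t - s)`. -/
def genBernoulli (𝓔 : Finset ℝ) (Bmax b q : ℝ) (n : ℕ) : OnlinePolicy 𝓔 n :=
  fun t w => decay Bmax q (genBernoulliState Bmax b q t w).2

/-- The online policies under consideration (each a policy for every length `n`): the generalized
Bernoulli policy with fraction `μ / Bmax`, and the binary quantization policies with a level
`x ∈ [0, Bmax]` and fraction `Pr(E_t ≥ x)`. -/
def policyFamily {Ω : Type*} [MeasurableSpace Ω] (P : Measure Ω) (E : ℕ → Ω → 𝓔) (Bmax b : ℝ) :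
    Set ((n : ℕ) → OnlinePolicy 𝓔 n) :=
  {genBernoulli 𝓔 Bmax b (clippedMean P E Bmax / Bmax)} ∪
    {g | ∃ x ∈ Set.Icc 0 Bmax, g = binaryQuantization 𝓔 x (P.real {ω | x ≤ (E 0 ω : ℝ)})}

end EnergyHarvesting

end

/-! Both kinds of policy are driven by binary restart marks: exponentially decaying power is spent
from a reserve that is refilled at each restart. The powers never exceed the reserve, and the
reserve never exceeds the battery level, so the policies are admissible. The power sequence is a
function of `n` bits, so its entropy is at most `n`.

The throughput is bounded by a drift argument (`throughput_ge_of_drift`): a nonnegative potential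
whose conditional increase is at most rate minus `κ` telescopes to throughput at least `κ - C / n`.
With `m` the power at a restart, the rate at age `k` falls short of `1/2 log (1 + m)` by at most `k`
times a constant, so a potential has to pay for the age, up to the next restart. For quantization
the restarts are i.i.d. and the gap is `1 / (2 ln 2)`. For the generalized Bernoulli policy the time
until the battery is full is controlled as in Wald's identity.

The latter policy is used for `μ / Bmax ≤ 2/3`. Otherwise level `Bmax / 2` keeps at least a quarter
of `μ`, costing one more bit. Either gap is at most `1.80`, and the entropy adds at most `1`.

The maximum exists because the admissible policies form a compact set, throughput is continuous on
it, and entropy is lower semicontinuous. -/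

namespace EnergyHarvesting

/-! ### Entropy of random variables with finitely many values. -/

section Entropy

variable {Ω : Type*} [MeasurableSpace Ω] {P : Measure Ω} {α β : Type*}

theorem entropy_eq_sum {X : Ω → α} (F : Finset α) (hF : ∀ ω, X ω ∈ F) :
    entropy P X = ∑ x ∈ F, Real.negMulLog (P.real (X ⁻¹' {x})) / Real.log 2 := by
  refine tsum_eq_sum fun x hx => ?_
  have : X ⁻¹' {x} = ∅ := by
    ext ω
    simp only [Set.mem_preimage, Set.mem_singleton_iff, Set.mem_empty_iff_false, iff_false]
    rintro rfl
    exact hx (hF ω)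
  simp [this]

theorem sum_measureReal_fiber [IsProbabilityMeasure P] {X : Ω → α} (F : Finset α)
    (hF : ∀ ω, X ω ∈ F) (hX : ∀ x, MeasurableSet (X ⁻¹' {x})) :
    ∑ x ∈ F, P.real (X ⁻¹' {x}) = 1 := by
  rw [sum_measureReal_preimage_singleton F fun y _ => hX y]
  have : X ⁻¹' (F : Set α) = Set.univ := by
    ext ω
    simp [hF ω]
  simp [this]

theorem entropy_le_logb_card [IsProbabilityMeasure P] {X : Ω → α} (F : Finset α)
    (hF : ∀ ω, X ω ∈ F) (hX : ∀ x, MeasurableSet (X ⁻¹' {x})) :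
    entropy P X ≤ Real.logb 2 F.card := by
  have hne : F.Nonempty := by
    by_contra h
    have := sum_measureReal_fiber (P := P) F hF hX
    simp [Finset.not_nonempty_iff_eq_empty.1 h] at this
  have hN : (0 : ℝ) < F.card := by exact_mod_cast hne.card_pos
  have key := Real.concaveOn_negMulLog.le_map_sum (t := F) (w := fun _ => (F.card : ℝ)⁻¹)
    (p := fun x => P.real (X ⁻¹' {x})) (fun _ _ => by positivity) (by simp [hN.ne'])
    (fun _ _ => measureReal_nonneg)
  simp only [smul_eq_mul] at key
  rw [← Finset.mul_sum, ← Finset.mul_sum, sum_measureReal_fiber F hF hX, mul_one,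
    Real.negMulLog, Real.log_inv] at key
  rw [entropy_eq_sum F hF, ← Finset.sum_div, Real.logb]
  refine div_le_div_of_nonneg_right ?_ (Real.log_nonneg (by norm_num))
  have h2 : (F.card : ℝ)⁻¹ * ∑ x ∈ F, Real.negMulLog (P.real (X ⁻¹' {x}))
      ≤ (F.card : ℝ)⁻¹ * Real.log F.card := by linarith
  exact le_of_mul_le_mul_left h2 (by positivity)

/-- Each `p x` is at most the total, so replacing `log` of the total by `log (p x)` inside the sum
only lowers the logarithms. -/
theorem negMulLog_sum_le (F : Finset α) (p : α → ℝ) (hp : ∀ x, 0 ≤ p x) :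
    Real.negMulLog (∑ x ∈ F, p x) ≤ ∑ x ∈ F, Real.negMulLog (p x) := by
  rw [Real.negMulLog, neg_mul, Finset.sum_mul, ← Finset.sum_neg_distrib]
  refine Finset.sum_le_sum fun x hx => ?_
  rw [Real.negMulLog, neg_mul]
  refine neg_le_neg ?_
  rcases (hp x).eq_or_lt with h | h
  · simp [← h]
  · exact mul_le_mul_of_nonneg_left
      (Real.log_le_log h (Finset.single_le_sum (fun i _ => hp i) hx)) (hp x)

/-- Processing a discrete random variable does not increase its entropy. -/
theorem entropy_comp_le [IsFiniteMeasure P] {X : Ω → α} (F : Finset α)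
    (hF : ∀ ω, X ω ∈ F) (hX : ∀ x, MeasurableSet (X ⁻¹' {x})) (φ : α → β) :
    entropy P (φ ∘ X) ≤ entropy P X := by
  classical
  rw [entropy_eq_sum (X := φ ∘ X) (F.image φ) fun ω => Finset.mem_image_of_mem φ (hF ω),
    entropy_eq_sum F hF, ← Finset.sum_div, ← Finset.sum_div]
  refine div_le_div_of_nonneg_right ?_ (Real.log_nonneg (by norm_num))
  rw [← Finset.sum_fiberwise_of_maps_to (g := φ) fun x hx => Finset.mem_image_of_mem φ hx]
  refine Finset.sum_le_sum fun y _ => ?_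
  have : P.real (φ ∘ X ⁻¹' {y}) = ∑ x ∈ F with φ x = y, P.real (X ⁻¹' {x}) := by
    rw [sum_measureReal_preimage_singleton _ fun x _ => hX x]
    congr 1
    ext ω
    simp [hF ω]
  rw [this]
  exact negMulLog_sum_le _ _ fun _ => measureReal_nonneg

end Entropy

end EnergyHarvesting

namespace EnergyHarvesting

/-! ### Averages over i.i.d. arrivals and the drift criterion. -/

section Drift

variable {𝓔 : Finset ℝ} {Ω : Type*} [MeasurableSpace Ω] {P : Measure Ω}
  {E : ℕ → Ω → 𝓔}

theorem measurable_prefix (hmeas : ∀ t, Measurable (E t)) (n : ℕ) :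
    Measurable fun ω (i : Fin n) => E i ω :=
  measurable_pi_lambda _ fun i => hmeas i

theorem indepFun_prefix (hmeas : ∀ t, Measurable (E t)) (hindep : iIndepFun E P) (n : ℕ) :
    IndepFun (fun ω (i : Fin n) => E i ω) (E n) P := by
  have h := hindep.indepFun_finset (Finset.range n) {n} (by simp) hmeas
  have hφ : Measurable fun (w : Finset.range n → 𝓔) (i : Fin n) =>
      w ⟨i, Finset.mem_range.2 i.2⟩ := by fun_prop
  have hψ : Measurable fun w : ({n} : Finset ℕ) → 𝓔 => w ⟨n, Finset.mem_singleton_self n⟩ := by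
    fun_prop
  exact h.comp hφ hψ

variable [IsProbabilityMeasure P]

theorem integrable_prefix (hmeas : ∀ t, Measurable (E t)) {n : ℕ} (f : (Fin n → 𝓔) → ℝ) :
    Integrable (fun ω => f fun i => E i ω) P :=
  Integrable.comp_measurable (g := f)
    (by
      have := Measure.isProbabilityMeasure_map (μ := P) (measurable_prefix hmeas n).aemeasurable
      exact Integrable.of_finite) (measurable_prefix hmeas n)

theorem integrable_arrival (hmeas : ∀ t, Measurable (E t)) (f : 𝓔 → ℝ) (t : ℕ) :
    Integrable (fun ω => f (E t ω)) P :=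
  Integrable.comp_measurable (g := f)
    (by
      have := Measure.isProbabilityMeasure_map (μ := P) (hmeas t).aemeasurable
      exact Integrable.of_finite) (hmeas t)

/-- Averaging a function of the first `n + 1` arrivals, the last arrival first. -/
theorem integral_prefix_succ (hmeas : ∀ t, Measurable (E t)) (hindep : iIndepFun E P)
    (hident : ∀ t, IdentDistrib (E t) (E 0) P P) {n : ℕ} (f : (Fin (n + 1) → 𝓔) → ℝ) :
    ∫ ω, f (fun i => E i ω) ∂P
      = ∫ ω, ∫ ω', f (Fin.snoc (α := fun _ => 𝓔) (fun i : Fin n => E i ω) (E 0 ω')) ∂P ∂P := by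
  have hW := measurable_prefix hmeas n
  have hprod := (indepFun_iff_map_prod_eq_prod_map_map hW.aemeasurable
    (hmeas n).aemeasurable).1 (indepFun_prefix hmeas hindep n)
  rw [(hident n).map_eq] at hprod
  have := Measure.isProbabilityMeasure_map (μ := P) hW.aemeasurable
  have := Measure.isProbabilityMeasure_map (μ := P) (hmeas 0).aemeasurable
  let F : (Fin n → 𝓔) × 𝓔 → ℝ := fun z => f (Fin.snoc (α := fun _ => 𝓔) z.1 z.2)
  have hF : ∀ ω, f (fun i => E i ω) = F ((fun i : Fin n => E i ω), E n ω) := by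
    intro ω
    congr 1
    ext i
    refine Fin.lastCases ?_ (fun i => ?_) i
    · simp
    · simp
  simp_rw [hF]
  rw [← integral_map (φ := fun ω => ((fun i : Fin n => E i ω), E n ω)) (f := F)
    (hW.prodMk (hmeas n)).aemeasurable (measurable_of_finite F).aestronglyMeasurable, hprod,
    integral_prod F Integrable.of_finite,
    integral_map hW.aemeasurable (measurable_of_finite _).aestronglyMeasurable]
  refine integral_congr_ae (.of_forall fun ω => ?_)
  exact integral_map (hmeas 0).aemeasurable (measurable_of_finite _).aestronglyMeasurable

/-- A nonnegative potential whose expected one-step increase is at most the excess of the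
instantaneous rate over `κ` bounds the throughput from below by `κ - O(1 / n)`. -/
theorem throughput_ge_of_drift (hmeas : ∀ t, Measurable (E t)) (hindep : iIndepFun E P)
    (hident : ∀ t, IdentDistrib (E t) (E 0) P P) (p V : (t : ℕ) → (Fin (t + 1) → 𝓔) → ℝ) (κ : ℝ)
    (hV : ∀ t w, 0 ≤ V t w)
    (hdrift : ∀ t w, ∫ ω, V (t + 1) (Fin.snoc (α := fun _ => 𝓔) w (E 0 ω)) ∂P
      ≤ V t w + 1 / 2 * Real.logb 2 (1 + p t w) - κ) :
    ∃ C, ∀ n : ℕ, 0 < n → κ - C / n ≤ throughput P E (fun t w => p t w : OnlinePolicy 𝓔 n) := by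
  let v : ℕ → ℝ := fun t => ∫ ω, V t (fun i => E i ω) ∂P
  let r : ℕ → ℝ := fun t => ∫ ω, 1 / 2 * Real.logb 2 (1 + p t (fun i => E i ω)) ∂P
  have hstep : ∀ t, v (t + 1) ≤ v t + r t - κ := by
    intro t
    have hi := integrable_prefix (P := P) hmeas (V t)
    have hj := integrable_prefix (P := P) hmeas fun w => 1 / 2 * Real.logb 2 (1 + p t w)
    have h1 : v (t + 1) ≤
        ∫ ω, (V t (fun i => E i ω) + 1 / 2 * Real.logb 2 (1 + p t fun i => E i ω) - κ) ∂P := by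
      simp only [v]
      rw [integral_prefix_succ hmeas hindep hident]
      exact integral_mono
        (integrable_prefix hmeas fun w =>
          ∫ ω', V (t + 1) (Fin.snoc (α := fun _ => 𝓔) w (E 0 ω')) ∂P)
        ((hi.add hj).sub (integrable_const κ)) fun ω => hdrift t _
    have hij : Integrable (fun ω => V t (fun i => E i ω)
      + 1 / 2 * Real.logb 2 (1 + p t fun i => E i ω)) P := hi.add hj
    rw [integral_sub hij (integrable_const κ), integral_add hi hj] at h1
    simpa [v, r] using h1
  -- Telescoped drift inequality; the final potential is nonnegative and will be dropped, leaving
  -- the constant `C = v 0`.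
  have hsum : ∀ n, n * κ - v 0 + v n ≤ ∑ t ∈ Finset.range n, r t := by
    intro n
    induction n with
    | zero => simp
    | succ n ih =>
      rw [Finset.sum_range_succ]
      push_cast
      linarith [hstep n]
  refine ⟨v 0, fun n hn => ?_⟩
  have hn' : (0 : ℝ) < n := by exact_mod_cast hn
  have hthr : throughput P E (fun t w => p t w : OnlinePolicy 𝓔 n)
      = 1 / n * ∑ t ∈ Finset.range n, r t := by
    simp only [throughput, OnlinePolicy.powers]
    rw [integral_finsetSum _ fun (t : Fin n) _ =>
      integrable_prefix hmeas fun w => 1 / 2 * Real.logb 2 (1 + p t w),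
      Finset.sum_range fun t => r t]
  have hvn : 0 ≤ v n := integral_nonneg fun ω => hV n _
  rw [hthr, one_div, inv_mul_eq_div, le_div_iff₀ hn', sub_mul, div_mul_cancel₀ _ hn'.ne']
  linarith [hsum n]

end Drift

end EnergyHarvesting

/-! ### Admissibility of the restart policies. -/

noncomputable section
namespace EnergyHarvesting

/-- The energy set aside for the current restart period at age `k`: what is left of `A` after `k`
slots of exponentially decaying allocation. -/
def reserve (A q : ℝ) : Option ℕ → ℝ
  | none => 0
  | some k => A * (1 - q) ^ k

section Reserve

variable {A q : ℝ}

theorem decay_eq_mul_reserve (a : Option ℕ) : decay A q a = q * reserve A q a := by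
  cases a with
  | none => simp [decay, reserve]
  | some k => simp only [decay, reserve]; ring

theorem reserve_map_succ (a : Option ℕ) :
    reserve A q (a.map (· + 1)) = reserve A q a - decay A q a := by
  cases a with
  | none => simp [decay, reserve]
  | some k => simp only [decay, reserve, Option.map_some]; ring

theorem reserve_nonneg (hA : 0 ≤ A) (hq1 : q ≤ 1) (a : Option ℕ) : 0 ≤ reserve A q a := by
  cases a with
  | none => exact le_rfl
  | some k => exact mul_nonneg hA (pow_nonneg (by linarith) k)

theorem decay_nonneg (hA : 0 ≤ A) (hq : 0 ≤ q) (hq1 : q ≤ 1) (a : Option ℕ) :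
    0 ≤ decay A q a := by
  rw [decay_eq_mul_reserve]
  exact mul_nonneg hq (reserve_nonneg hA hq1 a)

theorem decay_le_reserve (hA : 0 ≤ A) (hq1 : q ≤ 1) (a : Option ℕ) :
    decay A q a ≤ reserve A q a := by
  rw [decay_eq_mul_reserve]
  exact mul_le_of_le_one_left (reserve_nonneg hA hq1 a) hq1

end Reserve

section Admissibility

variable {𝓔 : Finset ℝ} {Bmax b q : ℝ}

theorem quantAge_succ (x : ℝ) (t : ℕ) (e : ℕ → 𝓔) :
    quantAge x (t + 1) (fun i => e i) =
      if x ≤ (e (t + 1) : ℝ) then some 0 else (quantAge x t fun i => e i).map (· + 1) := rfl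

/-- A restart arrival alone supplies the full reserve `x ≤ Bmax`. Between restarts the reserve loses
exactly the power spent, while the battery loses no more than that unless clipped at `Bmax`, which
is above the reserve anyway. -/
theorem reserve_quantAge_le_battery {x : ℝ} (h𝓔 : ∀ e ∈ 𝓔, 0 ≤ e) (hb : 0 ≤ b) (hx : 0 ≤ x)
    (hxB : x ≤ Bmax) (hq : 0 ≤ q) (hq1 : q ≤ 1) (n : ℕ) (e : ℕ → 𝓔) (t : ℕ) (ht : t < n) :
    reserve x q (quantAge x t fun i => e i)
      ≤ battery Bmax b ((binaryQuantization 𝓔 x q n).power e) (fun i => (e i : ℝ)) t := by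
  induction t with
  | zero =>
    have he := h𝓔 _ (e 0).2
    simp only [quantAge, battery]
    split_ifs with h
    · simp only [reserve, pow_zero, mul_one]
      simp only [Fin.val_zero] at h
      exact le_min (by linarith) hxB
    · exact le_min (by simp only [reserve]; linarith) (by simp only [reserve]; linarith)
  | succ t ih =>
    have ih := ih (by omega)
    have he := h𝓔 _ (e (t + 1)).2
    have hpow : (binaryQuantization 𝓔 x q n).power e t
        = decay x q (quantAge x t fun i => e i) := by
      simp [OnlinePolicy.power, binaryQuantization, show t < n by omega]
    have h1 := decay_le_reserve hx hq1 (quantAge x t fun i => e i)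
    have h2 := decay_nonneg hx hq hq1 (quantAge x t fun i => e i)
    have h3 : reserve x q (quantAge x t fun i => e i) ≤ Bmax :=
      ih.trans (by cases t <;> exact min_le_right _ _)
    rw [quantAge_succ]
    simp only [battery, hpow]
    split_ifs with h
    · simp only [reserve, pow_zero, mul_one]
      exact le_min (by linarith) hxB
    · rw [reserve_map_succ]
      exact le_min (by linarith) (by linarith)

theorem binaryQuantization_mem_admissible {x : ℝ} (h𝓔 : ∀ e ∈ 𝓔, 0 ≤ e) (hb : 0 ≤ b)
    (hx : 0 ≤ x) (hxB : x ≤ Bmax) (hq : 0 ≤ q) (hq1 : q ≤ 1) (n : ℕ) :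
    binaryQuantization 𝓔 x q n ∈ admissible 𝓔 Bmax b n := by
  intro e t ht
  have hpow : (binaryQuantization 𝓔 x q n).power e t = decay x q (quantAge x t fun i => e i) := by
    simp [OnlinePolicy.power, binaryQuantization, ht]
  have := reserve_quantAge_le_battery h𝓔 hb hx hxB hq hq1 n e t ht
  rw [hpow]
  exact ⟨decay_nonneg hx hq hq1 _, (decay_le_reserve hx hq1 _).trans this⟩

theorem genBernoulliState_succ (t : ℕ) (w : Fin (t + 2) → 𝓔) :
    genBernoulliState Bmax b q (t + 1) w =
      (min ((genBernoulliState Bmax b q t (Fin.init w)).1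
          - decay Bmax q (genBernoulliState Bmax b q t (Fin.init w)).2
          + (w (Fin.last (t + 1)) : ℝ)) Bmax,
        if min ((genBernoulliState Bmax b q t (Fin.init w)).1
          - decay Bmax q (genBernoulliState Bmax b q t (Fin.init w)).2
          + (w (Fin.last (t + 1)) : ℝ)) Bmax = Bmax then some 0
        else (genBernoulliState Bmax b q t (Fin.init w)).2.map (· + 1)) := rfl

theorem genBernoulliState_fst_le (t : ℕ) (w : Fin (t + 1) → 𝓔) :
    (genBernoulliState Bmax b q t w).1 ≤ Bmax := by
  cases t <;> exact min_le_right _ _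

theorem reserve_le_genBernoulliState (h𝓔 : ∀ e ∈ 𝓔, 0 ≤ e) (hB : 0 ≤ Bmax) (hb : 0 ≤ b)
    (hq : 0 ≤ q) (hq1 : q ≤ 1) (t : ℕ) (w : Fin (t + 1) → 𝓔) :
    reserve Bmax q (genBernoulliState Bmax b q t w).2 ≤ (genBernoulliState Bmax b q t w).1 := by
  induction t with
  | zero =>
    have he := h𝓔 _ (w 0).2
    simp only [genBernoulliState]
    split_ifs with h
    · simp [reserve, h]
    · exact le_min (by simp only [reserve]; linarith) hB
  | succ t ih =>
    have ih := ih (Fin.init w)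
    have he := h𝓔 _ (w (Fin.last (t + 1))).2
    have h2 := decay_nonneg hB hq hq1 (genBernoulliState Bmax b q t (Fin.init w)).2
    have h3 := genBernoulliState_fst_le (Bmax := Bmax) (b := b) (q := q) t (Fin.init w)
    rw [genBernoulliState_succ]
    dsimp only
    split_ifs with h
    · simp [reserve, h]
    · rw [reserve_map_succ]
      exact le_min (by linarith) (by linarith)

/-- The policy simulates the battery from the arrivals alone; this identifies the simulated level
with the level that its own powers produce. -/
theorem genBernoulliState_fst_eq_battery (n : ℕ) (e : ℕ → 𝓔) (t : ℕ) (ht : t < n) :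
    (genBernoulliState Bmax b q t fun i => e i).1
      = battery Bmax b ((genBernoulli 𝓔 Bmax b q n).power e) (fun i => (e i : ℝ)) t := by
  induction t with
  | zero => rfl
  | succ t ih =>
    have hpow : (genBernoulli 𝓔 Bmax b q n).power e t
        = decay Bmax q (genBernoulliState Bmax b q t fun i => e i).2 := by
      simp [OnlinePolicy.power, genBernoulli, show t < n by omega]
    rw [battery, hpow, ← ih (by omega)]
    rfl

theorem genBernoulli_mem_admissible (h𝓔 : ∀ e ∈ 𝓔, 0 ≤ e) (hB : 0 ≤ Bmax) (hb : 0 ≤ b)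
    (hq : 0 ≤ q) (hq1 : q ≤ 1) (n : ℕ) :
    genBernoulli 𝓔 Bmax b q n ∈ admissible 𝓔 Bmax b n := by
  intro e t ht
  have hpow : (genBernoulli 𝓔 Bmax b q n).power e t
      = decay Bmax q (genBernoulliState Bmax b q t fun i => e i).2 := by
    simp [OnlinePolicy.power, genBernoulli, ht]
  rw [hpow, ← genBernoulliState_fst_eq_battery n e t ht]
  exact ⟨decay_nonneg hB hq hq1 _, (decay_le_reserve hB hq1 _).trans
    (reserve_le_genBernoulliState h𝓔 hB hb hq hq1 t _)⟩

end Admissibility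

/-! ### At most one bit of entropy per slot. -/

section EntropyBound

/-- The number of slots since the last restart, when the restarts are marked by `r`. -/
def ageOfRestarts (r : ℕ → Bool) : ℕ → Option ℕ
  | 0 => if r 0 then some 0 else none
  | t + 1 => if r (t + 1) then some 0 else (ageOfRestarts r t).map (· + 1)

theorem ageOfRestarts_congr {r r' : ℕ → Bool} {t : ℕ} (h : ∀ s ≤ t, r s = r' s) :
    ageOfRestarts r t = ageOfRestarts r' t := by
  induction t with
  | zero => simp [ageOfRestarts, h 0 le_rfl]
  | succ t ih =>
    simp only [ageOfRestarts]
    rw [h _ le_rfl, ih fun s hs => h s (by omega)]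

variable {𝓔 : Finset ℝ} {Ω : Type*} [MeasurableSpace Ω] {P : Measure Ω}
  {E : ℕ → Ω → 𝓔}

theorem measurableSet_powers_fiber (hmeas : ∀ t, Measurable (E t)) {n : ℕ} (g : OnlinePolicy 𝓔 n)
    (x : Fin n → ℝ) : MeasurableSet (g.powers E ⁻¹' {x}) := by
  have hs : MeasurableSet {w : Fin n → 𝓔 |
      (fun t : Fin n => g t fun i => w (Fin.castLE t.2 i)) = x} := (Set.toFinite _).measurableSet
  exact measurable_prefix hmeas n hs

/-- A policy that is determined by the restart marks has entropy at most one bit per slot. -/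
theorem entropyPerSymbol_le_one [IsProbabilityMeasure P] (hmeas : ∀ t, Measurable (E t)) {n : ℕ}
    (hn : 0 < n) (g : OnlinePolicy 𝓔 n) (f : Option ℕ → ℝ) (r : (ℕ → 𝓔) → ℕ → Bool)
    (h : ∀ (e : ℕ → 𝓔) (t : Fin n), g t (fun i => e i) = f (ageOfRestarts (r e) t)) :
    entropyPerSymbol P E g ≤ 1 := by
  classical
  -- Rebuilds the powers from `n` marks. The value `false` after slot `n - 1` is immaterial, since
  -- the age at `t` uses only marks up to `t`.
  let φ : (Fin n → Bool) → Fin n → ℝ := fun u t =>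
    f (ageOfRestarts (fun s => if hs : s < n then u ⟨s, hs⟩ else false) t)
  have hF : ∀ ω, g.powers E ω ∈ Finset.univ.image φ := by
    intro ω
    refine Finset.mem_image.2 ⟨fun s => r (fun i => E i ω) s, Finset.mem_univ _, ?_⟩
    funext t
    have h1 := h (fun i => E i ω) t
    simp only [φ, OnlinePolicy.powers]
    rw [h1]
    congr 1
    refine ageOfRestarts_congr fun s hs => ?_
    simp [show s < n from hs.trans_lt t.2]
  have h1 := entropy_le_logb_card (P := P) _ hF (measurableSet_powers_fiber hmeas g)
  obtain ⟨ω⟩ : Nonempty Ω := nonempty_of_isProbabilityMeasure P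
  have hpos : (0 : ℝ) < (Finset.univ.image φ).card := by
    exact_mod_cast Finset.card_pos.2 ⟨_, hF ω⟩
  have h2 : ((Finset.univ.image φ).card : ℝ) ≤ 2 ^ n := by
    have := Finset.card_image_le (s := (Finset.univ : Finset (Fin n → Bool))) (f := φ)
    simp only [Finset.card_univ, Fintype.card_fun, Fintype.card_bool, Fintype.card_fin] at this
    exact_mod_cast this
  have h3 : Real.logb 2 (Finset.univ.image φ).card ≤ n := by
    refine (Real.logb_le_logb_of_le (by norm_num) hpos h2).trans_eq ?_
    rw [Real.logb_pow, Real.logb_self_eq_one (by norm_num), mul_one]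
  have hn' : (0 : ℝ) < n := by exact_mod_cast hn
  rw [entropyPerSymbol, one_div, inv_mul_le_iff₀ hn', mul_one]
  exact h1.trans h3

theorem quantAge_eq_ageOfRestarts (x : ℝ) (t : ℕ) (e : ℕ → 𝓔) :
    quantAge x t (fun i => e i) = ageOfRestarts (fun s => decide (x ≤ (e s : ℝ))) t := by
  induction t with
  | zero => simp [quantAge, ageOfRestarts]
  | succ t ih => simp [quantAge_succ, ageOfRestarts, ih]

open Classical in
theorem genBernoulliState_snd_eq_ageOfRestarts (Bmax b q : ℝ) (t : ℕ) (e : ℕ → 𝓔) :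
    (genBernoulliState Bmax b q t fun i => e i).2
      = ageOfRestarts
        (fun s => decide ((genBernoulliState Bmax b q s fun i => e i).1 = Bmax)) t := by
  induction t with
  | zero => simp [genBernoulliState, ageOfRestarts]
  | succ t ih =>
    rw [ageOfRestarts, ← ih]
    simp only [decide_eq_true_eq]
    by_cases h : (genBernoulliState Bmax b q (t + 1) fun i => e i).1 = Bmax
    · rw [if_pos h]
      exact if_pos h
    · rw [if_neg h]
      exact if_neg h

theorem entropyPerSymbol_binaryQuantization_le_one [IsProbabilityMeasure P]
    (hmeas : ∀ t, Measurable (E t)) (x q : ℝ) {n : ℕ} (hn : 0 < n) :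
    entropyPerSymbol P E (binaryQuantization 𝓔 x q n) ≤ 1 :=
  entropyPerSymbol_le_one hmeas hn _ (decay x q) _ fun e t => by
    rw [binaryQuantization, quantAge_eq_ageOfRestarts x t e]

theorem entropyPerSymbol_genBernoulli_le_one [IsProbabilityMeasure P]
    (hmeas : ∀ t, Measurable (E t)) (Bmax b q : ℝ) {n : ℕ} (hn : 0 < n) :
    entropyPerSymbol P E (genBernoulli 𝓔 Bmax b q n) ≤ 1 :=
  entropyPerSymbol_le_one hmeas hn _ (decay Bmax q) _ fun e t => by
    rw [genBernoulli, genBernoulliState_snd_eq_ageOfRestarts Bmax b q t e]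

end EntropyBound

end EnergyHarvesting
end

/-! ### Existence of the maximum. -/

noncomputable section
namespace EnergyHarvesting

section Maximum

variable {𝓔 : Finset ℝ} {n : ℕ}

/-- The power sequence of a policy as a function of the first `n` arrivals. -/
def OnlinePolicy.trajectory (g : OnlinePolicy 𝓔 n) (w : Fin n → 𝓔) : Fin n → ℝ :=
  fun t => g t fun i => w (Fin.castLE t.2 i)

theorem continuous_apply_apply_policy (t : Fin n) (w : Fin ((t : ℕ) + 1) → 𝓔) :
    Continuous fun g : OnlinePolicy 𝓔 n => g t w :=
  (continuous_apply w).comp (continuous_apply t)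

theorem continuous_trajectory (w : Fin n → 𝓔) :
    Continuous fun g : OnlinePolicy 𝓔 n => g.trajectory w :=
  continuous_pi fun t => continuous_apply_apply_policy t _

theorem continuous_power (e : ℕ → 𝓔) (t : ℕ) :
    Continuous fun g : OnlinePolicy 𝓔 n => g.power e t := by
  by_cases h : t < n
  · simpa [OnlinePolicy.power, h] using continuous_apply_apply_policy (𝓔 := 𝓔) ⟨t, h⟩ _
  · simpa [OnlinePolicy.power, h] using continuous_const

theorem continuous_battery (Bmax b : ℝ) (e : ℕ → 𝓔) (t : ℕ) :
    Continuous fun g : OnlinePolicy 𝓔 n =>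
      battery Bmax b (g.power e) (fun i => (e i : ℝ)) t := by
  induction t with
  | zero => exact continuous_const
  | succ t ih =>
    exact ((ih.sub (continuous_power e t)).add continuous_const).min continuous_const

theorem isClosed_admissible (Bmax b : ℝ) : IsClosed (admissible 𝓔 Bmax b n) := by
  have : admissible 𝓔 Bmax b n = ⋂ (e : ℕ → 𝓔) (t : ℕ) (_ : t < n), {g | 0 ≤ g.power e t ∧
      g.power e t ≤ battery Bmax b (g.power e) (fun i => (e i : ℝ)) t} := by
    ext g
    simp [admissible]
  rw [this]
  refine isClosed_iInter fun e => isClosed_iInter fun t => isClosed_iInter fun _ => ?_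
  exact (isClosed_le continuous_const (continuous_power e t)).inter
    (isClosed_le (continuous_power e t) (continuous_battery Bmax b e t))

theorem mem_Icc_of_mem_admissible {Bmax b : ℝ} {g : OnlinePolicy 𝓔 n}
    (hg : g ∈ admissible 𝓔 Bmax b n) (t : Fin n) (w : Fin ((t : ℕ) + 1) → 𝓔) :
    g t w ∈ Set.Icc 0 Bmax := by
  -- Any finite history extends to an infinite sequence by repeating its last arrival, so
  -- admissibility constrains every value of `g`.
  let e : ℕ → 𝓔 := fun i => w ⟨min i t, by omega⟩
  have he : (fun i : Fin ((t : ℕ) + 1) => e i) = w := by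
    funext i
    simp only [e]
    congr 1
    ext
    simp only
    omega
  have hpow : g.power e t = g t w := by
    simp [OnlinePolicy.power, he]
  obtain ⟨h1, h2⟩ := hg e t t.2
  rw [hpow] at h1 h2
  refine ⟨h1, h2.trans ?_⟩
  cases (t : ℕ) <;> exact min_le_right _ _

theorem isCompact_admissible (Bmax b : ℝ) : IsCompact (admissible 𝓔 Bmax b n) := by
  refine IsCompact.of_isClosed_subset (s := Set.pi Set.univ fun t : Fin n =>
    Set.pi Set.univ fun _ : Fin ((t : ℕ) + 1) → 𝓔 => Set.Icc 0 Bmax)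
    (isCompact_univ_pi fun t => isCompact_univ_pi fun _ => isCompact_Icc)
    (isClosed_admissible Bmax b) fun g hg t _ w _ => mem_Icc_of_mem_admissible hg t w

variable {Ω : Type*} [MeasurableSpace Ω] {P : Measure Ω} [IsProbabilityMeasure P] {E : ℕ → Ω → 𝓔}

theorem throughput_eq_sum (hmeas : ∀ t, Measurable (E t)) (g : OnlinePolicy 𝓔 n) :
    throughput P E g = 1 / n * ∑ w : Fin n → 𝓔, (P.map fun ω (i : Fin n) => E i ω).real {w} *
      ∑ t : Fin n, 1 / 2 * Real.logb 2 (1 + g.trajectory w t) := by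
  have hW := measurable_prefix hmeas n
  have := Measure.isProbabilityMeasure_map (μ := P) hW.aemeasurable
  rw [throughput]
  congr 1
  have h := integral_map (μ := P) hW.aemeasurable
    (f := fun w => ∑ t : Fin n, 1 / 2 * Real.logb 2 (1 + g.trajectory w t))
    (measurable_of_finite _).aestronglyMeasurable
  refine h.symm.trans ?_
  rw [integral_fintype Integrable.of_finite]
  simp only [smul_eq_mul]

theorem continuousOn_throughput (hmeas : ∀ t, Measurable (E t)) (Bmax b : ℝ) :
    ContinuousOn (fun g : OnlinePolicy 𝓔 n => throughput P E g) (admissible 𝓔 Bmax b n) := by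
  simp_rw [throughput_eq_sum hmeas, Real.logb]
  refine continuousOn_const.mul (continuousOn_finsetSum _ fun w _ => continuousOn_const.mul
    (continuousOn_finsetSum _ fun t _ => continuousOn_const.mul (ContinuousOn.div_const ?_ _)))
  refine ContinuousOn.log (continuousOn_const.add
    (continuous_apply_apply_policy t _).continuousOn) fun g hg => ?_
  have := (mem_Icc_of_mem_admissible hg t fun i => w (Fin.castLE t.2 i)).1
  exact (show 0 < 1 + g t fun i => w (Fin.castLE t.2 i) by linarith).ne'

/-- Lower semicontinuity of entropy: the finitely many distinct trajectories of `g` stay distinct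
under small perturbations, so the powers of `g` are a function of those of any nearby `g'`.
Perturbing can split values but not merge them. -/
theorem eventually_entropy_le (hmeas : ∀ t, Measurable (E t)) (g : OnlinePolicy 𝓔 n) :
    ∀ᶠ g' in nhds g, entropyPerSymbol P E g ≤ entropyPerSymbol P E g' := by
  classical
  have h : ∀ w w' : Fin n → 𝓔, ∀ᶠ g' in nhds g,
      OnlinePolicy.trajectory g' w = OnlinePolicy.trajectory g' w' →
        g.trajectory w = g.trajectory w' := by
    intro w w'
    by_cases hw : g.trajectory w = g.trajectory w'
    · exact .of_forall fun _ _ => hw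
    · filter_upwards [(isOpen_ne_fun (continuous_trajectory w)
        (continuous_trajectory w')).mem_nhds hw] with g' hg' h
      exact absurd h hg'
  filter_upwards [eventually_all.2 fun w => eventually_all.2 (h w)] with g' hg'
  obtain ⟨φ, hφ⟩ := (Function.factorsThrough_iff g.trajectory).1
    (show Function.FactorsThrough g.trajectory (OnlinePolicy.trajectory g') from hg')
  have hcomp : g.powers E = φ ∘ OnlinePolicy.powers g' E := by
    funext ω
    exact congrFun hφ fun i => E i ω
  refine mul_le_mul_of_nonneg_left ?_ (by positivity)
  rw [hcomp]
  exact entropy_comp_le (Finset.univ.image (OnlinePolicy.trajectory g'))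
    (fun ω => Finset.mem_image.2 ⟨fun i => E i ω, Finset.mem_univ _, rfl⟩)
    (measurableSet_powers_fiber hmeas g') φ

theorem exists_isMaxOn_throughput_sub_entropy (hmeas : ∀ t, Measurable (E t)) {Bmax b : ℝ}
    (hne : (admissible 𝓔 Bmax b n).Nonempty) :
    ∃ g ∈ admissible 𝓔 Bmax b n,
      IsMaxOn (fun g => throughput P E g - entropyPerSymbol P E g) (admissible 𝓔 Bmax b n) g := by
  refine UpperSemicontinuousOn.exists_isMaxOn hne (isCompact_admissible Bmax b) ?_
  simp_rw [sub_eq_add_neg]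
  refine (continuousOn_throughput hmeas Bmax b).upperSemicontinuousOn.add ?_
  intro g _ y hy
  filter_upwards [nhdsWithin_le_nhds (eventually_entropy_le (P := P) hmeas g)] with g' hg'
  exact (neg_le_neg hg').trans_lt hy

end Maximum

end EnergyHarvesting
end

/-! ### Rate loss and throughput of the two kinds of policy. -/

noncomputable section
namespace EnergyHarvesting

section RateLoss

theorem logb_one_add_sub_le {m s : ℝ} (hm : 0 ≤ m) (hs : 0 < s) (hs1 : s ≤ 1) (k : ℕ) :
    Real.logb 2 (1 + m) - Real.logb 2 (1 + m * s ^ k) ≤ k * (-Real.logb 2 s) := by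
  have hsk : 0 < s ^ k := pow_pos hs k
  have hsk1 : s ^ k ≤ 1 := pow_le_one₀ hs.le hs1
  have h : (1 + m) * s ^ k ≤ 1 + m * s ^ k := by nlinarith
  have h2 := Real.logb_le_logb_of_le (b := 2) (by norm_num) (by positivity) h
  rw [Real.logb_mul (by positivity) hsk.ne', Real.logb_pow] at h2
  linarith

/-- `M` is the slope of the potential in the age. Resetting with probability `q` gains `q * (k *
M)`, which must cover the loss at age `k`; ageing by one slot costs `(1 - q) * M`, which is the
final gap. -/
theorem exists_rateLoss_slope {q m : ℝ} (hq : 0 < q) (hq1 : q ≤ 1) (hm : 0 ≤ m) :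
    ∃ M, 0 ≤ M ∧ (∀ k : ℕ, 1 / 2 * Real.logb 2 (1 + m)
      - 1 / 2 * Real.logb 2 (1 + m * (1 - q) ^ k) ≤ q * (k * M)) ∧
      (1 - q) * M ≤ 1 / (2 * Real.log 2) := by
  have hlog2 : 0 < Real.log 2 := Real.log_pos (by norm_num)
  -- For `q = 1` the slope `-log (1 - q) / q` is meaningless. All power is spent at the restart, so
  -- the whole rate serves as `M`, and the factor `1 - q` removes the cost.
  rcases hq1.eq_or_lt with rfl | hlt
  · have hc : 0 ≤ 1 / 2 * Real.logb 2 (1 + m) :=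
      mul_nonneg (by norm_num) (Real.logb_nonneg (by norm_num) (by linarith))
    refine ⟨1 / 2 * Real.logb 2 (1 + m), hc, fun k => ?_, by rw [sub_self, zero_mul]; positivity⟩
    rcases k with _ | k
    · simp
    · simp only [sub_self, ne_eq, Nat.add_eq_zero_iff, one_ne_zero, and_false, not_false_eq_true,
        zero_pow, mul_zero, add_zero, Real.logb_one, sub_zero, one_mul]
      exact le_mul_of_one_le_left hc (by push_cast; linarith [Nat.cast_nonneg (α := ℝ) k])
  · have hs : 0 < 1 - q := by linarith
    have hl : Real.logb 2 (1 - q) ≤ 0 :=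
      Real.logb_nonpos (by norm_num) hs.le (by linarith)
    refine ⟨-(1 / 2 * Real.logb 2 (1 - q)) / q, div_nonneg (by linarith) hq.le, fun k => ?_, ?_⟩
    · have := logb_one_add_sub_le hm hs (by linarith) k
      have e : q * (k * (-(1 / 2 * Real.logb 2 (1 - q)) / q))
          = k * (-(1 / 2 * Real.logb 2 (1 - q))) := by field_simp
      rw [e]
      linarith
    · have h1 := Real.one_sub_inv_le_log_of_pos hs
      have h2 : (1 - q) * -Real.log (1 - q) ≤ q := by
        have := mul_le_mul_of_nonneg_left h1 hs.le
        rw [mul_sub, mul_inv_cancel₀ hs.ne'] at this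
        linarith
      have e : (1 - q) * (-(1 / 2 * Real.logb 2 (1 - q)) / q)
          = (1 - q) * -Real.log (1 - q) / (q * (2 * Real.log 2)) := by
        rw [Real.logb]; field_simp
      rw [e, div_le_div_iff₀ (by positivity) (by positivity)]
      nlinarith

/-- The logarithm is bounded by the chord-type estimate `-log (1 - q) ≤ q / √(1 - q)`. -/
theorem neg_log_one_sub_le {q : ℝ} (hq : 0 ≤ q) (hq1 : q < 1) :
    -Real.log (1 - q) ≤ q / √(1 - q) := by
  have hs : 0 < 1 - q := by linarith
  have hr : 0 < √(1 - q) := Real.sqrt_pos.2 hs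
  have h0 : 0 ≤ -Real.log √(1 - q) := by
    have := Real.log_nonpos hr.le (Real.sqrt_le_one.2 (by linarith))
    linarith
  -- `y ≤ sinh y` at `y = -log √(1 - q)`, where `sinh y = q / (2 √(1 - q))`.
  have h := Real.self_le_sinh_iff.2 h0
  rw [Real.sinh_eq, neg_neg, Real.exp_neg, Real.exp_log hr, Real.log_sqrt hs.le] at h
  have hsq : √(1 - q) * √(1 - q) = 1 - q := Real.mul_self_sqrt hs.le
  have e : (√(1 - q))⁻¹ - √(1 - q) = q / √(1 - q) := by
    field_simp
    linarith
  rw [e] at h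
  linarith

end RateLoss

variable {𝓔 : Finset ℝ} {Ω : Type*} [MeasurableSpace Ω] {P : Measure Ω} [IsProbabilityMeasure P]
  {E : ℕ → Ω → 𝓔}

theorem quantAge_snoc (x : ℝ) (t : ℕ) (w : Fin (t + 1) → 𝓔) (a : 𝓔) :
    quantAge x (t + 1) (Fin.snoc (α := fun _ => 𝓔) w a) =
      if x ≤ (a : ℝ) then some 0 else (quantAge x t w).map (· + 1) := by
  rw [quantAge, Fin.init_snoc, Fin.snoc_last]

theorem throughput_binaryQuantization_ge (hmeas : ∀ t, Measurable (E t)) (hindep : iIndepFun E P)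
    (hident : ∀ t, IdentDistrib (E t) (E 0) P P) {x : ℝ} (hx : 0 ≤ x)
    (hpos : 0 < P.real {ω | x ≤ (E 0 ω : ℝ)}) :
    ∃ C, ∀ n : ℕ, 0 < n →
      1 / 2 * Real.logb 2 (1 + x * P.real {ω | x ≤ (E 0 ω : ℝ)}) - 1 / (2 * Real.log 2) - C / n ≤
        throughput P E (binaryQuantization 𝓔 x (P.real {ω | x ≤ (E 0 ω : ℝ)}) n) := by
  have hS : MeasurableSet {ω | x ≤ (E 0 ω : ℝ)} :=
    measurableSet_le measurable_const (measurable_subtype_coe.comp (hmeas 0))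
  set S := {ω | x ≤ (E 0 ω : ℝ)} with hSdef
  set q := P.real S
  have hq1 : q ≤ 1 := measureReal_le_one
  obtain ⟨M, hM, hloss, hgap⟩ := exists_rateLoss_slope hpos hq1 (mul_nonneg hx hpos.le)
  set c := 1 / 2 * Real.logb 2 (1 + x * q)
  have hc : 0 ≤ c := mul_nonneg (by norm_num)
    (Real.logb_nonneg (by norm_num) (by linarith [mul_nonneg hx hpos.le]))
  let pot : Option ℕ → ℝ := fun a => a.elim (c / q) fun k => k * M
  have hpot : ∀ a, 0 ≤ pot a := by
    rintro (_ | k)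
    · exact div_nonneg hc hpos.le
    · exact mul_nonneg k.cast_nonneg hM
  refine throughput_ge_of_drift hmeas hindep hident (fun t w => decay x q (quantAge x t w))
    (fun t w => pot (quantAge x t w)) _ (fun t w => hpot _) fun t w => ?_
  have hint : ∫ ω, pot (quantAge x (t + 1) (Fin.snoc (α := fun _ => 𝓔) w (E 0 ω))) ∂P
      = (1 - q) * pot ((quantAge x t w).map (· + 1)) := by
    have h1 : ∀ ω, pot (quantAge x (t + 1) (Fin.snoc (α := fun _ => 𝓔) w (E 0 ω)))
        = Sᶜ.indicator (fun _ => pot ((quantAge x t w).map (· + 1))) ω := by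
      intro ω
      rw [quantAge_snoc]
      by_cases h : x ≤ (E 0 ω : ℝ)
      · simp [h, S, pot]
      · simp [h, S]
    simp_rw [h1]
    rw [integral_indicator_const _ hS.compl, probReal_compl_eq_one_sub hS, smul_eq_mul]
  rw [hint]
  cases quantAge x t w with
  | none =>
    have e : (1 - q) * (c / q) = c / q - c := by field_simp
    have : 0 ≤ 1 / (2 * Real.log 2) := le_trans (mul_nonneg (by linarith) hM) hgap
    simp only [pot, Option.map_none, Option.elim, decay, add_zero, Real.logb_one, mul_zero]
    linarith
  | some k =>
    have := hloss k
    simp only [pot, Option.map_some, Option.elim, decay]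
    push_cast
    linarith

theorem genBernoulliState_snoc (Bmax b q : ℝ) (t : ℕ) (w : Fin (t + 1) → 𝓔) (a : 𝓔) :
    genBernoulliState Bmax b q (t + 1) (Fin.snoc (α := fun _ => 𝓔) w a) =
      (min ((genBernoulliState Bmax b q t w).1
          - decay Bmax q (genBernoulliState Bmax b q t w).2 + (a : ℝ)) Bmax,
        if min ((genBernoulliState Bmax b q t w).1
          - decay Bmax q (genBernoulliState Bmax b q t w).2 + (a : ℝ)) Bmax = Bmax then some 0
        else (genBernoulliState Bmax b q t w).2.map (· + 1)) := by
  rw [genBernoulliState_succ, Fin.init_snoc, Fin.snoc_last]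

/-- The surplus of the battery over the reserve gains the whole arrival in each slot until the
battery is full. Hence `(2 * Bmax + reserve - level) / μ` bounds the expected waiting time and falls
by one per slot on average; it is weighted by the bound on the current rate loss. -/
theorem throughput_genBernoulli_ge (h𝓔 : ∀ e ∈ 𝓔, 0 ≤ e) (hmeas : ∀ t, Measurable (E t))
    (hindep : iIndepFun E P) (hident : ∀ t, IdentDistrib (E t) (E 0) P P) {Bmax b : ℝ}
    (hB : 0 < Bmax) (hb : 0 ≤ b) (hμ : 0 < clippedMean P E Bmax)
    (hμB : clippedMean P E Bmax < Bmax) :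
    ∃ C, ∀ n : ℕ, 0 < n →
      1 / 2 * Real.logb 2 (1 + clippedMean P E Bmax)
          - -(1 / 2 * Real.logb 2 (1 - clippedMean P E Bmax / Bmax))
            * (2 / (clippedMean P E Bmax / Bmax) - 1) - C / n ≤
        throughput P E (genBernoulli 𝓔 Bmax b (clippedMean P E Bmax / Bmax) n) := by
  have hmean : ∫ ω, min (E 0 ω : ℝ) Bmax ∂P = clippedMean P E Bmax := rfl
  set μ := clippedMean P E Bmax
  set q := μ / Bmax with hqdef
  have hq : 0 < q := div_pos hμ hB
  have hq1 : q < 1 := (div_lt_one hB).2 hμB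
  have hBq : Bmax * q = μ := by rw [hqdef]; field_simp
  set lam := -(1 / 2 * Real.logb 2 (1 - q))
  have hlam : 0 ≤ lam := by
    have := Real.logb_nonpos (b := 2) (by norm_num) (show 0 ≤ 1 - q by linarith) (by linarith)
    simp only [lam]
    linarith
  set c := 1 / 2 * Real.logb 2 (1 + μ)
  have hc : 0 ≤ c := mul_nonneg (by norm_num) (Real.logb_nonneg (by norm_num) (by linarith))
  let weight : Option ℕ → ℝ := fun a => a.elim c fun k => lam * k
  have hweight : ∀ a, 0 ≤ weight a := by
    rintro (_ | k)
    · exact hc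
    · exact mul_nonneg hlam k.cast_nonneg
  -- `2 * Bmax` rather than `Bmax` leaves room for the overshoot: the bracket remains nonnegative
  -- after subtracting a clipped arrival, even when that arrival fills the battery.
  let pot : ℝ × Option ℕ → ℝ := fun s => weight s.2 * ((2 * Bmax + reserve Bmax q s.2 - s.1) / μ)
  refine throughput_ge_of_drift hmeas hindep hident
    (fun t w => decay Bmax q (genBernoulliState Bmax b q t w).2)
    (fun t w => pot (genBernoulliState Bmax b q t w)) _ (fun t w => ?_) fun t w => ?_
  · refine mul_nonneg (hweight _) (div_nonneg ?_ hμ.le)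
    linarith [genBernoulliState_fst_le (Bmax := Bmax) (b := b) (q := q) t w,
      reserve_nonneg (A := Bmax) (q := q) hB.le hq1.le (genBernoulliState Bmax b q t w).2]
  have hle := genBernoulliState_fst_le (Bmax := Bmax) (b := b) (q := q) t w
  have hres := reserve_le_genBernoulliState h𝓔 hB.le hb hq.le hq1.le t w
  set s := genBernoulliState Bmax b q t w with hs
  have hres0 := reserve_nonneg (A := Bmax) (q := q) hB.le hq1.le s.2
  have hdec := decay_le_reserve (A := Bmax) (q := q) hB.le hq1.le s.2
  have hpt : ∀ ω, pot (genBernoulliState Bmax b q (t + 1) (Fin.snoc (α := fun _ => 𝓔) w (E 0 ω)))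
      ≤ weight (s.2.map (· + 1)) / μ * (2 * Bmax + reserve Bmax q s.2 - s.1)
        - weight (s.2.map (· + 1)) / μ * min (E 0 ω : ℝ) Bmax := by
    intro ω
    have he := h𝓔 _ (E 0 ω).2
    rw [genBernoulliState_snoc, ← hs, ← mul_sub]
    have hw := hweight (s.2.map (· + 1))
    split_ifs with h
    · have h0 : pot (min (s.1 - decay Bmax q s.2 + (E 0 ω : ℝ)) Bmax, some 0) = 0 := by
        simp [pot, weight]
      rw [h0]
      refine mul_nonneg (div_nonneg hw hμ.le) ?_
      linarith [min_le_right (E 0 ω : ℝ) Bmax]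
    · have hlt : s.1 - decay Bmax q s.2 + (E 0 ω : ℝ) < Bmax := by
        by_contra hge
        exact h (min_eq_right (not_lt.1 hge))
      simp only [pot]
      rw [min_eq_left hlt.le, min_eq_left (by linarith : (E 0 ω : ℝ) ≤ Bmax), reserve_map_succ]
      apply le_of_eq
      ring
  have hintE : Integrable (fun ω => min (E 0 ω : ℝ) Bmax) P :=
    integrable_arrival hmeas (fun a => min (a : ℝ) Bmax) 0
  have hint := integral_mono (μ := P)
    (integrable_arrival hmeas (fun a =>
      pot (genBernoulliState Bmax b q (t + 1) (Fin.snoc (α := fun _ => 𝓔) w a))) 0)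
    ((integrable_const _).sub (hintE.const_mul _)) hpt
  refine hint.trans ?_
  simp only [Pi.sub_apply]
  rw [integral_sub (integrable_const _) (hintE.const_mul _), integral_const, probReal_univ,
    one_smul, integral_const_mul, hmean, div_mul_cancel₀ _ hμ.ne']
  have hgap : 2 / q - 1 = (2 * Bmax - μ) / μ := by
    rw [hqdef]; field_simp
  have hgap0 : 0 ≤ lam * ((2 * Bmax - μ) / μ) :=
    mul_nonneg hlam (div_nonneg (by linarith) hμ.le)
  rw [hgap]
  clear_value s
  obtain ⟨β, a⟩ := s
  cases a with
  | none =>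
    simp only [pot, weight, Option.map_none, Option.elim, decay, add_zero, Real.logb_one, mul_zero]
    have e : c / μ * (2 * Bmax + reserve Bmax q none - β)
        = c * ((2 * Bmax + reserve Bmax q none - β) / μ) := by ring
    linarith
  | some k =>
    have hloss := logb_one_add_sub_le hμ.le (show 0 < 1 - q by linarith) (by linarith) k
    simp only at hle hres hres0
    simp only [pot, weight, Option.map_some, Option.elim, decay, hBq]
    push_cast
    set r := reserve Bmax q (some k)
    -- Raising the weight from `k` to `k + 1` costs `lam` times the waiting bound, at most `2 * Bmax
    -- / μ` because the reserve is below the level.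
    have h1 : lam * ((2 * Bmax + r - β) / μ) ≤ lam * (2 * Bmax / μ) := by gcongr; linarith
    have h2 : lam * ((2 * Bmax - μ) / μ) = lam * (2 * Bmax / μ) - lam := by field_simp
    have h3 : lam * (k + 1) / μ * (2 * Bmax + r - β) = lam * k * ((2 * Bmax + r - β) / μ)
        + lam * ((2 * Bmax + r - β) / μ) := by ring
    have h4 : c - 1 / 2 * Real.logb 2 (1 + μ * (1 - q) ^ k) ≤ lam * k := by
      simp only [c, lam]
      linarith
    linarith

end EnergyHarvesting
end

/-! ### Choice of the policy and numerical constants. -/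

namespace EnergyHarvesting

variable {𝓔 : Finset ℝ} {Ω : Type*} [MeasurableSpace Ω] {P : Measure Ω} [IsProbabilityMeasure P]
  {E : ℕ → Ω → 𝓔}

theorem clippedMean_pos (h𝓔 : ∀ e ∈ 𝓔, 0 ≤ e) (hmeas : ∀ t, Measurable (E t)) {Bmax : ℝ}
    (hB : 0 < Bmax) (hpos : 0 < P {ω | 0 < (E 0 ω : ℝ)}) : 0 < clippedMean P E Bmax := by
  refine (integral_pos_iff_support_of_nonneg (fun ω => le_min (h𝓔 _ (E 0 ω).2) hB.le)
    (integrable_arrival hmeas (fun a => min (a : ℝ) Bmax) 0)).2 (hpos.trans_le (measure_mono ?_))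
  intro ω hω
  exact (lt_min hω hB).ne'

theorem clippedMean_le (hmeas : ∀ t, Measurable (E t)) (Bmax : ℝ) :
    clippedMean P E Bmax ≤ Bmax := by
  have := integral_mono (μ := P) (integrable_arrival hmeas (fun a => min (a : ℝ) Bmax) 0)
    (integrable_const Bmax) fun ω => min_le_right (E 0 ω : ℝ) Bmax
  simpa [clippedMean] using this

theorem clippedMean_le_add_mul_prob (hmeas : ∀ t, Measurable (E t)) (Bmax x : ℝ) :
    clippedMean P E Bmax ≤ x + (Bmax - x) * P.real {ω | x ≤ (E 0 ω : ℝ)} := by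
  have hS : MeasurableSet {ω | x ≤ (E 0 ω : ℝ)} :=
    measurableSet_le measurable_const (measurable_subtype_coe.comp (hmeas 0))
  have hi : Integrable ({ω | x ≤ (E 0 ω : ℝ)}.indicator fun _ => Bmax - x) P :=
    (integrable_const _).indicator hS
  have h : clippedMean P E Bmax
      ≤ ∫ ω, (x + {ω | x ≤ (E 0 ω : ℝ)}.indicator (fun _ => Bmax - x) ω) ∂P := by
    refine integral_mono (integrable_arrival hmeas (fun a => min (a : ℝ) Bmax) 0)
      ((integrable_const x).add hi) fun ω => ?_
    by_cases hω : x ≤ (E 0 ω : ℝ)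
    · simp [hω]
    · simp [hω, (not_le.1 hω).le]
  rw [integral_add (integrable_const x) hi, integral_const, probReal_univ, one_smul,
    integral_indicator_const _ hS, smul_eq_mul] at h
  linarith

theorem neg_logb_mul_le {q : ℝ} (hq : 0 < q) (hq1 : q ≤ 2 / 3) :
    -(1 / 2 * Real.logb 2 (1 - q)) * (2 / q - 1) ≤ 1.80 := by
  have hlog2 : 0.69 < Real.log 2 := by linarith [Real.log_two_gt_d9]
  have hs : 0 < 1 - q := by linarith
  have hr : 0 < √(1 - q) := Real.sqrt_pos.2 hs
  have h := neg_log_one_sub_le hq.le (by linarith)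
  -- `2.484 = 2 * 1.80 * 0.69`, with `0.69 < log 2`. The squared inequality is convex in `q` and
  -- holds at `0` and `2/3`.
  have h2 : 2 - q ≤ 2.484 * √(1 - q) := by
    have : 2 - q ≤ √(2.484 ^ 2 * (1 - q)) := Real.le_sqrt_of_sq_le (by nlinarith)
    rwa [Real.sqrt_mul (by norm_num), Real.sqrt_sq (by norm_num)] at this
  have e : -(1 / 2 * Real.logb 2 (1 - q)) * (2 / q - 1)
      = -Real.log (1 - q) * (2 - q) / (2 * q * Real.log 2) := by
    rw [Real.logb]; field_simp
  rw [e, div_le_iff₀ (by positivity)]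
  calc -Real.log (1 - q) * (2 - q) ≤ q / √(1 - q) * (2.484 * √(1 - q)) :=
        mul_le_mul h h2 (by linarith) (by positivity)
    _ = 2.484 * q := by field_simp
    _ ≤ 1.80 * (2 * q * Real.log 2) := by nlinarith

theorem exists_policyFamily_throughput_ge (h𝓔 : ∀ e ∈ 𝓔, 0 ≤ e) (hmeas : ∀ t, Measurable (E t))
    (hindep : iIndepFun E P) (hident : ∀ t, IdentDistrib (E t) (E 0) P P)
    (hpos : 0 < P {ω | 0 < (E 0 ω : ℝ)}) {Bmax b : ℝ} (hB : 0 < Bmax) (hb : 0 ≤ b) :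
    ∃ g ∈ policyFamily P E Bmax b, ∃ C, ∀ n : ℕ, 0 < n →
      1 / 2 * Real.logb 2 (1 + clippedMean P E Bmax) - 1.80 - C / n ≤ throughput P E (g n) := by
  have hμ := clippedMean_pos h𝓔 hmeas hB hpos
  rcases le_or_gt (clippedMean P E Bmax / Bmax) (2 / 3) with hq | hq
  · have hμB : clippedMean P E Bmax < Bmax := by
      rw [div_le_iff₀ hB] at hq
      linarith
    obtain ⟨C, hC⟩ := throughput_genBernoulli_ge h𝓔 hmeas hindep hident hB hb hμ hμB
    refine ⟨_, Or.inl rfl, C, fun n hn => le_trans ?_ (hC n hn)⟩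
    linarith [neg_logb_mul_le (div_pos hμ hB) hq]
  · rw [lt_div_iff₀ hB] at hq
    have hp := clippedMean_le_add_mul_prob (P := P) hmeas Bmax (Bmax / 2)
    set p := P.real {ω | Bmax / 2 ≤ (E 0 ω : ℝ)}
    -- `Bmax / 2 * p ≥ μ - Bmax / 2`, and `Bmax < 3/2 * μ` makes this at least `μ / 4`.
    have hxp : clippedMean P E Bmax / 4 ≤ Bmax / 2 * p := by linarith
    have hp0 : 0 < p := by
      by_contra h
      nlinarith
    obtain ⟨C, hC⟩ := throughput_binaryQuantization_ge hmeas hindep hident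
      (by linarith : 0 ≤ Bmax / 2) hp0
    refine ⟨_, Or.inr ⟨Bmax / 2, ⟨by linarith, by linarith⟩, rfl⟩, C,
      fun n hn => le_trans ?_ (hC n hn)⟩
    have h1 : Real.logb 2 (1 + clippedMean P E Bmax) - 2 ≤ Real.logb 2 (1 + Bmax / 2 * p) := by
      have h := Real.logb_le_logb_of_le (b := 2) (by norm_num)
        (show 0 < (1 + clippedMean P E Bmax) / 2 ^ 2 by positivity)
        (show (1 + clippedMean P E Bmax) / 2 ^ 2 ≤ 1 + Bmax / 2 * p by linarith)
      rw [Real.logb_div (by positivity) (by norm_num), Real.logb_pow,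
        Real.logb_self_eq_one (by norm_num)] at h
      push_cast at h
      linarith
    have h2 : 1 / (2 * Real.log 2) ≤ 0.8 := by
      have hlog2 : 0.69 < Real.log 2 := by linarith [Real.log_two_gt_d9]
      rw [div_le_iff₀ (by positivity)]
      linarith
    linarith

theorem coe_le_liminf_of_sub_div_le {κ C : ℝ} {u : ℕ → EReal}
    (h : ∀ n : ℕ, 0 < n → ((κ - C / n : ℝ) : EReal) ≤ u n) :
    (κ : EReal) ≤ liminf u atTop := by
  have ht : Tendsto (fun n : ℕ => ((κ - C / n : ℝ) : EReal)) atTop (nhds κ) := by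
    refine EReal.tendsto_coe.2 ?_
    simpa using (tendsto_const_nhds (x := κ)).sub (tendsto_const_div_atTop_nhds_zero_nat C)
  rw [← ht.liminf_eq]
  exact liminf_le_liminf ((eventually_gt_atTop 0).mono h)

end EnergyHarvesting

/-- Lower limits live in the complete lattice `EReal`, so no boundedness conditions arise; the
supremum in the last clause is a maximum by the third. -/
theorem proposition2 {Ω : Type*} [MeasurableSpace Ω] (P : Measure Ω) [IsProbabilityMeasure P]
    (𝓔 : Finset ℝ) (h𝓔 : ∀ e ∈ 𝓔, 0 ≤ e)
    (E : ℕ → Ω → 𝓔) (hmeas : ∀ t, Measurable (E t)) (hindep : iIndepFun E P)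
    (hident : ∀ t, IdentDistrib (E t) (E 0) P P)
    (hpos : 0 < P {ω | 0 < (E 0 ω : ℝ)})
    (Bmax b : ℝ) (hBmax : 0 < Bmax) (hb : b ∈ Set.Icc 0 Bmax) :
    -- every policy of the family is admissible and has entropy per symbol at most one bit
    (∀ g ∈ EnergyHarvesting.policyFamily P E Bmax b, ∀ n : ℕ, 0 < n →
      g n ∈ EnergyHarvesting.admissible 𝓔 Bmax b n ∧
        EnergyHarvesting.entropyPerSymbol P E (g n) ≤ 1) ∧
    -- one of them achieves the throughput gap
    (∃ g ∈ EnergyHarvesting.policyFamily P E Bmax b,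
      (((1 / 2) * Real.logb 2 (1 + EnergyHarvesting.clippedMean P E Bmax) - 1.80 : ℝ) : EReal) ≤
        liminf (fun n : ℕ => ((EnergyHarvesting.throughput P E (g n) : ℝ) : EReal)) atTop) ∧
    -- the maximum of throughput minus entropy per symbol exists
    (∀ n : ℕ, 0 < n → ∃ g ∈ EnergyHarvesting.admissible 𝓔 Bmax b n,
      IsMaxOn (fun g => EnergyHarvesting.throughput P E g
        - EnergyHarvesting.entropyPerSymbol P E g)
        (EnergyHarvesting.admissible 𝓔 Bmax b n) g) ∧
    -- and its lower limit is bounded below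
    (((1 / 2) * Real.logb 2 (1 + EnergyHarvesting.clippedMean P E Bmax) - 2.80 : ℝ) : EReal) ≤
      liminf (fun n : ℕ => ⨆ g ∈ EnergyHarvesting.admissible 𝓔 Bmax b n,
        ((EnergyHarvesting.throughput P E g
          - EnergyHarvesting.entropyPerSymbol P E g : ℝ) : EReal)) atTop := by
  have hμ0 := (EnergyHarvesting.clippedMean_pos h𝓔 hmeas hBmax hpos).le
  have hμB := EnergyHarvesting.clippedMean_le (P := P) hmeas Bmax
  have hfam : ∀ g ∈ EnergyHarvesting.policyFamily P E Bmax b, ∀ n : ℕ, 0 < n →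
      g n ∈ EnergyHarvesting.admissible 𝓔 Bmax b n ∧
        EnergyHarvesting.entropyPerSymbol P E (g n) ≤ 1 := by
    rintro g (rfl | ⟨x, hx, rfl⟩) n hn
    · exact ⟨EnergyHarvesting.genBernoulli_mem_admissible h𝓔 hBmax.le hb.1
        (div_nonneg hμ0 hBmax.le) ((div_le_one hBmax).2 hμB) n,
        EnergyHarvesting.entropyPerSymbol_genBernoulli_le_one hmeas _ _ _ hn⟩
    · exact ⟨EnergyHarvesting.binaryQuantization_mem_admissible h𝓔 hb.1 hx.1 hx.2
        measureReal_nonneg measureReal_le_one n,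
        EnergyHarvesting.entropyPerSymbol_binaryQuantization_le_one hmeas _ _ hn⟩
  obtain ⟨g, hg, C, hC⟩ := EnergyHarvesting.exists_policyFamily_throughput_ge h𝓔 hmeas hindep
    hident hpos hBmax hb.1
  refine ⟨hfam, ⟨g, hg, EnergyHarvesting.coe_le_liminf_of_sub_div_le fun n hn =>
    EReal.coe_le_coe_iff.2 (hC n hn)⟩, fun n hn =>
    EnergyHarvesting.exists_isMaxOn_throughput_sub_entropy hmeas ⟨g n, (hfam g hg n hn).1⟩,
    EnergyHarvesting.coe_le_liminf_of_sub_div_le (C := C) fun n hn => ?_⟩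
  refine le_trans ?_ (le_iSup₂_of_le (g n) (hfam g hg n hn).1 le_rfl)
  refine EReal.coe_le_coe_iff.2 ?_
  linarith [hC n hn, (hfam g hg n hn).2]
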